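/- **Theorem.** Let $k$ be a field of characteristic zero and let $M,N\ge 2$ be integers such that either $M=2$ and $N$ is prime, or $M$ is prime and $N=2$. Let $$\Gamma_{M,N}=\langle g_0,\dots,g_{M-1}\mid g_0^N=\dots=g_{M-1}^N=1,\ [g_{i_1}\cdots g_{i_N},\,g_{j_1}\cdots g_{j_N}]=1 \rangle,$$ where the commutator relations range over all $i_1,\dots,i_N,j_1,\dots,j_N\in\{0,\dots,M-1\}$, and let the cyclic group $\mathbb Z_M=\langle h\rangle$ act on $\Gamma_{M,N}$ by $h\cdot g_i=g_{i+1}$ (indices modulo $M$). Let $k[\Gamma_{M,N}]\rtimes k^{\mathbb Z_M}$ be the smash coproduct Hopf algebra: as an algebra it is $k[\Gamma_{M,N}]\otimes k^{\mathbb Z_M}$ (with $r\#f$ standing for $r\otimes f$ and $\delta_x$ for the indicator function of $x$), and its comultiplication, counit and antipode are $$\Delta(r\#\delta_x)=\sum_{l\in\mathbb Z_M} (r\#\delta_l)\otimes (l^{-1}\cdot r\,\#\,\delta_{l^{-1}x}),\qquad \varepsilon(r\#\delta_x)=\delta_{x,1},\qquad S(r\#\delta_x)=x^{-1}\cdot r^{-1}\,\#\,\delta_{x^{-1}}.$$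 Let $Q=(Q_{ic})$, $0\le i\le M-1$, $0\le c\le N-1$, be a matrix with entries in $k^\times$ such that $Q_{0c}=1=Q_{i0}$ for all $i,c$ (indices modulo $M$ and $N$ respectively), and put $\theta_{ic}=\dfrac{Q_{i-1,c}\,Q_{i,c-1}}{Q_{ic}\,Q_{i-1,c-1}}$. With $\epsilon_0,\dots,\epsilon_{N-1}$ the canonical basis of $k^N$ (indices modulo $N$), let $\rho_Q:k[\Gamma_{M,N}]\rtimes k^{\mathbb Z_M}\to \mathrm{End}(k^N)$ be the algebra map determined by $$\rho_Q(g_i\#1)(\epsilon_c)=\theta_{ic}\,\epsilon_{c-1},\qquad \rho_Q(1\#f)=f(h)\,\mathrm{id}.$$ If at least one of the elements $Q_{ic}$ is not a root of unity, then $\rho_Q$ is inner faithful. Here an algebra map $\rho:A\to R$ from a Hopf algebra $A$ to an algebra $R$ is called *inner faithful* if $(A,\mathrm{id}_A,\rho)$ is its Hopf image, that is, a final object among the triples $(L,q,\varphi)$ in which $L$ is a Hopf algebra, $q:A\to L$ is a surjective Hopf algebra map and $\varphi:L\to R$ is an algebra map with $\rho=\varphi q$: for every such triple there is a unique Hopf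 algebra map $f:L\to A$ with $fq=\mathrm{id}_A$ and $\rho f=\varphi$. -/

import Mathlib

open scoped TensorProduct

noncomputable section

/-! ### The smash coproduct Hopf algebra -/

/-- The underlying algebra of the smash coproduct `k[Γ] ⋊ k^H`: the tensor product algebra
`k[Γ] ⊗ k^H`, where `k^H` is the algebra of functions on `H`. It is a type synonym, since its
coalgebra structure is not the tensor product one. -/
def SmashCoproduct (k Γ H : Type*) [Field k] [Group Γ] [Group H] : Type _ :=
  MonoidAlgebra k Γ ⊗[k] (H → k)

namespace SmashCoproduct

section Algebra

variable (k Γ H : Type*) [Field k] [Group Γ] [Group H]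

instance : Ring (SmashCoproduct k Γ H) :=
  inferInstanceAs (Ring (MonoidAlgebra k Γ ⊗[k] (H → k)))

instance : Algebra k (SmashCoproduct k Γ H) :=
  inferInstanceAs (Algebra k (MonoidAlgebra k Γ ⊗[k] (H → k)))

variable {k Γ H}

/-- The element `r # f` of the smash coproduct, for `r ∈ Γ` and `f ∈ k^H`. -/
def elt (r : Γ) (f : H → k) : SmashCoproduct k Γ H :=
  (MonoidAlgebra.single r (1 : k) ⊗ₜ[k] f : MonoidAlgebra k Γ ⊗[k] (H → k))

/-- `r # f` as a linear function of `f`. -/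
def eltLin (r : Γ) : (H → k) →ₗ[k] SmashCoproduct k Γ H :=
  TensorProduct.mk k (MonoidAlgebra k Γ) (H → k) (MonoidAlgebra.single r (1 : k))

@[simp] lemma eltLin_apply (r : Γ) (f : H → k) : eltLin r f = elt r f := rfl

lemma elt_mul (r s : Γ) (f g : H → k) : elt r f * elt s g = elt (r * s) (f * g) := by
  refine (Algebra.TensorProduct.tmul_mul_tmul _ _ _ _).trans ?_
  simp [elt, MonoidAlgebra.single_mul_single]

lemma one_eq : (1 : SmashCoproduct k Γ H) = elt 1 1 := rfl

lemma elt_add (r : Γ) (f g : H → k) : elt r (f + g) = elt r f + elt r g :=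
  (eltLin r).map_add f g

lemma elt_smul (r : Γ) (a : k) (f : H → k) : elt r (a • f) = a • elt r f :=
  (eltLin r).map_smul a f

lemma elt_zero (r : Γ) : elt r (0 : H → k) = 0 := (eltLin r).map_zero

lemma elt_sum {ι : Type*} (s : Finset ι) (r : Γ) (f : ι → H → k) :
    elt r (∑ i ∈ s, f i) = ∑ i ∈ s, elt r (f i) := map_sum (eltLin r) f s

/-- The linear map out of the smash coproduct with prescribed values `F r f` on `r # f`. -/
def linLift {P : Type*} [AddCommGroup P] [Module k P] (F : Γ → (H → k) →ₗ[k] P) :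
    SmashCoproduct k Γ H →ₗ[k] P :=
  TensorProduct.lift
    ((Finsupp.lsum k fun r => (LinearMap.lsmul k ((H → k) →ₗ[k] P)).flip (F r)) ∘ₗ
      (MonoidAlgebra.coeffLinearEquiv k).toLinearMap)

lemma linLift_elt {P : Type*} [AddCommGroup P] [Module k P] (F : Γ → (H → k) →ₗ[k] P)
    (r : Γ) (f : H → k) : linLift F (elt r f) = F r f := by
  refine (TensorProduct.lift.tmul _ _).trans ?_
  simp

lemma linearMap_ext {P : Type*} [AddCommGroup P] [Module k P]
    {φ ψ : SmashCoproduct k Γ H →ₗ[k] P} (h : ∀ r f, φ (elt r f) = ψ (elt r f)) : φ = ψ := by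
  refine TensorProduct.ext (MonoidAlgebra.lhom_ext' fun r => LinearMap.ext fun a => ?_)
  refine LinearMap.ext fun f => ?_
  have e : (MonoidAlgebra.single r a ⊗ₜ[k] f : MonoidAlgebra k Γ ⊗[k] (H → k)) =
      a • (elt r f : SmashCoproduct k Γ H) := by
    refine Eq.trans ?_ (TensorProduct.smul_tmul' a (MonoidAlgebra.single r (1 : k)) f).symm
    simp
  change φ (MonoidAlgebra.single r a ⊗ₜ[k] f : MonoidAlgebra k Γ ⊗[k] (H → k)) =
    ψ (MonoidAlgebra.single r a ⊗ₜ[k] f : MonoidAlgebra k Γ ⊗[k] (H → k))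
  rw [e]
  exact (map_smul φ _ _).trans ((congrArg (a • ·) (h r f)).trans (map_smul ψ _ _).symm)

/-- The algebra map out of `k[Γ] ⊗ k^H` given by a multiplicative map on `Γ` and an algebra map on
`k^H` whose images commute. -/
def algLift {R : Type*} [Ring R] [Algebra k R] (F : Γ →* R) (φ : (H → k) →ₐ[k] R)
    (hc : ∀ r f, Commute (F r) (φ f)) : SmashCoproduct k Γ H →ₐ[k] R :=
  Algebra.TensorProduct.lift (MonoidAlgebra.lift k R Γ F) φ (fun x f => by
    induction x using MonoidAlgebra.induction_linear with
    | zero => simp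
    | add x y hx hy => rw [map_add]; exact hx.add_left hy
    | single r a => rw [MonoidAlgebra.lift_single]; exact (hc r f).smul_left a)

lemma algLift_elt {R : Type*} [Ring R] [Algebra k R] (F : Γ →* R) (φ : (H → k) →ₐ[k] R)
    (hc : ∀ r f, Commute (F r) (φ f)) (r : Γ) (f : H → k) :
    algLift F φ hc (elt r f) = F r * φ f := by
  refine (Algebra.TensorProduct.lift_tmul _ _ _ _ _).trans ?_
  simp

end Algebra

section Hopf

variable (k Γ H : Type*) [Field k] [Group Γ] [Group H] [Fintype H] [DecidableEq H]
  [MulDistribMulAction H Γ]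

/-- The linear map underlying the comultiplication:
`r # f ↦ ∑ l, (r # δ_l) ⊗ (l⁻¹ • r # f(l ·))`. -/
def comulLin : SmashCoproduct k Γ H →ₗ[k] SmashCoproduct k Γ H ⊗[k] SmashCoproduct k Γ H :=
  linLift fun r => ∑ l : H,
    (TensorProduct.mk k _ _ (elt r (Pi.single l (1 : k)))) ∘ₗ
      (eltLin (l⁻¹ • r)) ∘ₗ (LinearMap.funLeft k k (fun x : H => l * x))

/-- The linear map underlying the counit: `r # f ↦ f 1`. -/
def counitLin : SmashCoproduct k Γ H →ₗ[k] k := linLift fun _ => LinearMap.proj 1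

/-- The antipode: `r # f ↦ ∑ h, f h • (h⁻¹ • r⁻¹ # δ_{h⁻¹})`. -/
def antipodeLin : SmashCoproduct k Γ H →ₗ[k] SmashCoproduct k Γ H :=
  linLift fun r => ∑ h : H,
    (LinearMap.proj h : (H → k) →ₗ[k] k).smulRight (elt (h⁻¹ • r⁻¹) (Pi.single h⁻¹ (1 : k)))

variable {k Γ H}

lemma comulLin_elt (r : Γ) (f : H → k) :
    comulLin k Γ H (elt r f) = ∑ l : H,
      elt r (Pi.single l (1 : k)) ⊗ₜ[k] elt (l⁻¹ • r) (fun x => f (l * x)) := by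
  rw [comulLin, linLift_elt, LinearMap.sum_apply]
  rfl

lemma counitLin_elt (r : Γ) (f : H → k) : counitLin k Γ H (elt r f) = f 1 := by
  rw [counitLin, linLift_elt]; rfl

lemma antipodeLin_elt (r : Γ) (f : H → k) :
    antipodeLin k Γ H (elt r f) =
      ∑ h : H, f h • elt (h⁻¹ • r⁻¹) (Pi.single h⁻¹ (1 : k)) := by
  rw [antipodeLin, linLift_elt, LinearMap.sum_apply]
  rfl

lemma antipodeLin_elt_single (r : Γ) (h : H) :
    antipodeLin k Γ H (elt r (Pi.single h (1 : k))) = elt (h⁻¹ • r⁻¹) (Pi.single h⁻¹ (1 : k)) := by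
  rw [antipodeLin_elt, Finset.sum_eq_single h]
  · simp
  · intro b _ hb; simp [hb]
  · simp

lemma comp_mul_single (l m : H) :
    (fun x => (Pi.single m (1 : k) : H → k) (l * x)) = Pi.single (l⁻¹ * m) (1 : k) := by
  funext x
  simp only [Pi.single_apply, eq_inv_mul_iff_mul_eq]

lemma elt_eq_sum (r : Γ) (f : H → k) : elt r f = ∑ h : H, f h • elt r (Pi.single h (1 : k)) := by
  simp_rw [← elt_smul]
  rw [← elt_sum]
  congr 1
  funext x
  simp [Finset.sum_apply, Pi.single_apply]

lemma linearMap_ext_single {P : Type*} [AddCommGroup P] [Module k P]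
    {φ ψ : SmashCoproduct k Γ H →ₗ[k] P}
    (h : ∀ r x, φ (elt r (Pi.single x (1 : k))) = ψ (elt r (Pi.single x (1 : k)))) : φ = ψ :=
  linearMap_ext fun r f => by simp_rw [elt_eq_sum r f, map_sum, map_smul, h]

lemma comulLin_elt_single (r : Γ) (h : H) :
    comulLin k Γ H (elt r (Pi.single h (1 : k))) = ∑ l : H,
      elt r (Pi.single l (1 : k)) ⊗ₜ[k] elt (l⁻¹ • r) (Pi.single (l⁻¹ * h) (1 : k)) := by
  simp_rw [comulLin_elt, comp_mul_single]

instance : Coalgebra k (SmashCoproduct k Γ H) where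
  comul := comulLin k Γ H
  counit := counitLin k Γ H
  coassoc := by
    refine linearMap_ext_single fun r h => ?_
    simp only [LinearMap.comp_apply, comulLin_elt_single, map_sum, LinearMap.rTensor_tmul,
      LinearMap.lTensor_tmul, TensorProduct.sum_tmul, TensorProduct.tmul_sum,
      LinearEquiv.coe_coe, TensorProduct.assoc_tmul]
    rw [Finset.sum_comm]
    refine Finset.sum_congr rfl fun l _ => ?_
    refine Fintype.sum_equiv (Equiv.mulLeft l⁻¹) _ _ fun m => ?_
    simp [smul_smul, mul_assoc]
  rTensor_counit_comp_comul := by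
    refine linearMap_ext_single fun r h => ?_
    simp only [LinearMap.comp_apply, comulLin_elt_single, map_sum, LinearMap.rTensor_tmul,
      counitLin_elt, TensorProduct.mk_apply]
    rw [Finset.sum_eq_single 1]
    · simp
    · intro b _ hb; simp [hb.symm]
    · simp
  lTensor_counit_comp_comul := by
    refine linearMap_ext_single fun r h => ?_
    simp only [LinearMap.comp_apply, comulLin_elt_single, map_sum, LinearMap.lTensor_tmul,
      counitLin_elt, LinearMap.flip_apply, TensorProduct.mk_apply]
    rw [Finset.sum_eq_single h]
    · simp
    · intro b _ hb
      rw [Pi.single_apply, if_neg, TensorProduct.tmul_zero]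
      intro e; exact hb (inv_mul_eq_one.mp e.symm)
    · simp

lemma comul_eq : (Coalgebra.comul : SmashCoproduct k Γ H →ₗ[k] _) = comulLin k Γ H := rfl

lemma counit_eq : (Coalgebra.counit : SmashCoproduct k Γ H →ₗ[k] k) = counitLin k Γ H := rfl

lemma bilin_ext {P : Type*} [AddCommGroup P] [Module k P]
    {φ ψ : SmashCoproduct k Γ H →ₗ[k] SmashCoproduct k Γ H →ₗ[k] P}
    (h : ∀ r f s g, φ (elt r f) (elt s g) = ψ (elt r f) (elt s g)) : φ = ψ :=
  linearMap_ext fun r f => linearMap_ext fun s g => h r f s g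

instance : Bialgebra k (SmashCoproduct k Γ H) where
  counit_one := by rw [counit_eq, one_eq, counitLin_elt]; rfl
  mul_compr₂_counit := by
    refine bilin_ext fun r f s g => ?_
    simp [counit_eq, elt_mul, counitLin_elt]
  comul_one := by
    rw [comul_eq, one_eq, comulLin_elt]
    simp only [smul_one]
    have : (fun x : H => (1 : H → k) x) = 1 := rfl
    rw [Algebra.TensorProduct.one_def, one_eq, elt_eq_sum 1 (1 : H → k), TensorProduct.sum_tmul]
    refine Finset.sum_congr rfl fun l _ => ?_
    rw [← elt_eq_sum]
    simp
    rfl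
  mul_compr₂_comul := by
    refine bilin_ext fun r f s g => ?_
    simp only [LinearMap.compr₂_apply, LinearMap.mul_apply', LinearMap.compl₁₂_apply, comul_eq,
      elt_mul, comulLin_elt, Finset.sum_mul_sum, Algebra.TensorProduct.tmul_mul_tmul]
    refine Finset.sum_congr rfl fun l _ => ?_
    rw [Finset.sum_eq_single l]
    · rw [smul_mul']
      congr 2
      rw [← Pi.single_mul, one_mul]
    · intro m _ hm
      have : (Pi.single l 1 * Pi.single m 1 : H → k) = 0 := by
        funext x
        by_cases hx : x = l
        · subst hx; simp [hm.symm]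
        · simp [hx]
      rw [this, elt_zero, TensorProduct.zero_tmul]
    · simp

lemma single_mul_single_ne {l m : H} (hm : l ≠ m) :
    (Pi.single l 1 * Pi.single m 1 : H → k) = 0 := by
  funext x
  by_cases hx : x = l
  · subst hx; simp [hm]
  · simp [hx]

instance : HopfAlgebra k (SmashCoproduct k Γ H) where
  antipode := antipodeLin k Γ H
  mul_antipode_rTensor_comul := by
    refine linearMap_ext_single fun r h => ?_
    simp only [LinearMap.comp_apply, comul_eq, counit_eq, comulLin_elt_single, map_sum,
      LinearMap.rTensor_tmul, antipodeLin_elt_single, LinearMap.mul'_apply, elt_mul,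
      counitLin_elt, Algebra.linearMap_apply]
    by_cases hh : h = 1
    · subst hh
      simp only [mul_one, ← Pi.single_mul, smul_inv', inv_mul_cancel, Pi.single_eq_same, map_one]
      rw [one_eq, elt_eq_sum 1 (1 : H → k)]
      refine Fintype.sum_equiv (Equiv.inv H) _ _ fun l => ?_
      simp
    · rw [Pi.single_apply, if_neg (Ne.symm hh), map_zero]
      refine Finset.sum_eq_zero fun l _ => ?_
      rw [single_mul_single_ne, elt_zero]
      simpa using hh
  mul_antipode_lTensor_comul := by
    refine linearMap_ext_single fun r h => ?_
    simp only [LinearMap.comp_apply, comul_eq, counit_eq, comulLin_elt_single, map_sum,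
      LinearMap.lTensor_tmul, antipodeLin_elt_single, LinearMap.mul'_apply, elt_mul,
      counitLin_elt, Algebra.linearMap_apply]
    by_cases hh : h = 1
    · subst hh
      simp only [mul_one, inv_inv, ← Pi.single_mul, smul_inv', smul_inv_smul, mul_inv_cancel,
        Pi.single_eq_same, map_one]
      rw [one_eq, elt_eq_sum 1 (1 : H → k)]
      simp
    · rw [Pi.single_apply, if_neg (Ne.symm hh), map_zero]
      refine Finset.sum_eq_zero fun l _ => ?_
      rw [single_mul_single_ne, elt_zero]
      intro e
      apply hh
      have : h⁻¹ * l = l := by simpa using e.symm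
      simpa using this

/-- The comultiplication `Δ(r # δ_h) = ∑ l, (r # δ_l) ⊗ (l⁻¹ • r # δ_{l⁻¹ h})`. -/
theorem comul_elt_single (r : Γ) (h : H) :
    Coalgebra.comul (R := k) (elt r (Pi.single h (1 : k)) : SmashCoproduct k Γ H) = ∑ l : H,
      elt r (Pi.single l (1 : k)) ⊗ₜ[k] elt (l⁻¹ • r) (Pi.single (l⁻¹ * h) (1 : k)) :=
  comulLin_elt_single r h

/-- The counit `ε(r # δ_h) = δ_{h,1}`. -/
theorem counit_elt_single (r : Γ) (h : H) :
    Coalgebra.counit (R := k) (elt r (Pi.single h (1 : k)) : SmashCoproduct k Γ H) =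
      if h = 1 then 1 else 0 := by
  rw [counit_eq, counitLin_elt, Pi.single_apply]
  simp only [eq_comm]

/-- The antipode `S(r # δ_h) = h⁻¹ • r⁻¹ # δ_{h⁻¹}`. -/
theorem antipode_elt_single (r : Γ) (h : H) :
    HopfAlgebra.antipode k (elt r (Pi.single h (1 : k)) : SmashCoproduct k Γ H) =
      elt (h⁻¹ • r⁻¹) (Pi.single h⁻¹ (1 : k)) :=
  antipodeLin_elt_single r h

end Hopf

end SmashCoproduct

/-! ### Hopf images and inner faithfulness -/

universe u v w

/-- A factorization `(L, q, φ)` of an algebra map `ρ : A → R` defined on a Hopf algebra `A`: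
`L` is a Hopf algebra, `q : A → L` is a surjective Hopf algebra map, `φ : L → R` is an algebra
map, and `ρ = φ ∘ q`. Since `q` is surjective, every such `L` has a copy in the universe of `A`. -/
structure HopfFactorization {k : Type u} {A : Type v} {R : Type w} [Field k] [Ring A]
    [HopfAlgebra k A] [Ring R] [Algebra k R] (ρ : A →ₐ[k] R) where
  /-- The Hopf algebra `L`. -/
  L : Type v
  /-- The ring structure of `L`. -/
  [ring : Ring L]
  /-- The Hopf algebra structure of `L`. -/
  [hopf : HopfAlgebra k L]
  /-- The surjective Hopf algebra map `q : A → L`. -/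
  q : A →ₐc[k] L
  surjective_q : Function.Surjective q
  /-- The algebra map `φ : L → R`. -/
  φ : L →ₐ[k] R
  fac : ∀ a, φ (q a) = ρ a

attribute [instance] HopfFactorization.ring HopfFactorization.hopf

namespace HopfFactorization

variable {k : Type u} {A : Type v} {R : Type w} [Field k] [Ring A] [HopfAlgebra k A] [Ring R]
  [Algebra k R]

/-- The factorization `(A, id, ρ)` of `ρ`. -/
def self (ρ : A →ₐ[k] R) : HopfFactorization ρ where
  L := A
  q := BialgHom.id k A
  surjective_q := Function.surjective_id
  φ := ρ
  fac _ := rfl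

/-- A factorization `F = (A_ρ, p, ρ')` is the Hopf image of `ρ` if it is a final object among the
factorizations: for every factorization `(L, q, φ)` there is a unique Hopf algebra map
`f : L → A_ρ` with `f ∘ q = p` and `ρ' ∘ f = φ`. -/
def IsHopfImage {ρ : A →ₐ[k] R} (F : HopfFactorization ρ) : Prop :=
  ∀ G : HopfFactorization ρ, ∃! f : G.L →ₐc[k] F.L,
    (∀ a, f (G.q a) = F.q a) ∧ ∀ x, F.φ (f x) = G.φ x

end HopfFactorization

/-- An algebra map `ρ : A → R` on a Hopf algebra `A` is inner faithful if `(A, id, ρ)` is the Hopf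
image of `ρ`. -/
def InnerFaithful {k : Type u} {A : Type v} {R : Type w} [Field k] [Ring A] [HopfAlgebra k A]
    [Ring R] [Algebra k R] (ρ : A →ₐ[k] R) : Prop :=
  (HopfFactorization.self ρ).IsHopfImage

/-! ### The groups `Γ_{M,N}` with their cyclic actions -/

section Groups

open scoped commutatorElement

/-- The relators of `Γ_{M,N}`: the powers `g_i ^ N` and the commutators
`[g_{i_1} ⋯ g_{i_N}, g_{j_1} ⋯ g_{j_N}]`. The generators are indexed by `ℤ/M`. -/
def GammaRels (M N : ℕ) : Set (FreeGroup (ZMod M)) :=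
  {x | ∃ i, x = FreeGroup.of i ^ N} ∪
  {x | ∃ i j : Fin N → ZMod M,
    x = ⁅(List.ofFn fun a => FreeGroup.of (i a)).prod, (List.ofFn fun a => FreeGroup.of (j a)).prod⁆}

/-- The group `Γ_{M,N}`. -/
abbrev Gamma (M N : ℕ) : Type := PresentedGroup (GammaRels M N)

namespace Gamma

/-- The generator `g_i` of `Γ_{M,N}`. -/
def g {M N : ℕ} (i : ZMod M) : Gamma M N := PresentedGroup.of i

variable {M N : ℕ}

/-- The group morphism out of `Γ_{M,N}` with prescribed values on the generators. -/
def lift {G : Type*} [Group G] (x : ZMod M → G) (hpow : ∀ i, x i ^ N = 1)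
    (hcomm : ∀ i j : Fin N → ZMod M,
      Commute (List.ofFn fun a => x (i a)).prod (List.ofFn fun a => x (j a)).prod) :
    Gamma M N →* G :=
  PresentedGroup.toGroup (f := x) (by
    rintro r (⟨i, rfl⟩ | ⟨i, j, rfl⟩)
    · simpa using hpow i
    · rw [map_commutatorElement, commutatorElement_eq_one_iff_commute]
      simpa [map_list_prod, List.map_ofFn, Function.comp_def] using hcomm i j)

@[simp] lemma lift_g {G : Type*} [Group G] (x : ZMod M → G) (hpow : ∀ i, x i ^ N = 1)
    (hcomm : ∀ i j : Fin N → ZMod M,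
      Commute (List.ofFn fun a => x (i a)).prod (List.ofFn fun a => x (j a)).prod)
    (i : ZMod M) : lift x hpow hcomm (g i) = x i :=
  PresentedGroup.toGroup.of _

lemma g_pow (i : ZMod M) : (g i : Gamma M N) ^ N = 1 := by
  have h : PresentedGroup.mk (GammaRels M N) (FreeGroup.of i ^ N) = 1 :=
    PresentedGroup.one_of_mem (Or.inl ⟨i, rfl⟩)
  rwa [map_pow] at h

lemma g_commute (i j : Fin N → ZMod M) :
    Commute (List.ofFn fun a => (g (i a) : Gamma M N)).prod
      (List.ofFn fun a => (g (j a) : Gamma M N)).prod := by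
  have h := PresentedGroup.one_of_mem (rels := GammaRels M N) (Or.inr ⟨i, j, rfl⟩)
  rw [map_commutatorElement, commutatorElement_eq_one_iff_commute] at h
  simp only [map_list_prod, List.map_ofFn, Function.comp_def] at h
  exact h

/-- The endomorphism `g_i ↦ g_{i+a}` of `Γ_{M,N}`. -/
def shift (a : ZMod M) : Gamma M N →* Gamma M N :=
  lift (fun i => g (i + a)) (fun _ => g_pow _) (fun _ _ => g_commute _ _)

/-- The action of the cyclic group `ℤ/M = ⟨h⟩` (written multiplicatively) on `Γ_{M,N}` by cyclic
permutation of the generators: `h ^ a` maps `g_i` to `g_{i+a}`. -/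
instance : MulDistribMulAction (Multiplicative (ZMod M)) (Gamma M N) where
  smul a := shift a.toAdd
  one_smul r := by
    change shift 0 r = MonoidHom.id _ r
    congr 1
    exact PresentedGroup.ext fun i => (lift_g ..).trans (by simp [g])
  mul_smul a b r := by
    change shift (a.toAdd + b.toAdd) r = (shift a.toAdd).comp (shift b.toAdd) r
    congr 1
    refine PresentedGroup.ext fun i => (lift_g ..).trans ?_
    change _ = shift _ (shift _ (g i))
    rw [shift, shift, lift_g, lift_g, add_comm a.toAdd, add_assoc]
  smul_mul a r s := map_mul (shift a.toAdd) r s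
  smul_one a := map_one (shift a.toAdd)

lemma smul_g (a : Multiplicative (ZMod M)) (i : ZMod M) :
    a • (g i : Gamma M N) = g (i + a.toAdd) := lift_g ..

end Gamma

end Groups

/-! ### The representations `ρ_Q` -/

section Representation

variable {k : Type*} [Field k] {M N : ℕ}

/-- The automorphism of `k^N` mapping the basis vector `ε_c` to `w_c ε_{c-1}`
(indices modulo `N`). -/
def weightedShift (w : ZMod N → kˣ) : (ZMod N → k) ≃ₗ[k] (ZMod N → k) where
  toFun v d := w (d + 1) * v (d + 1)
  map_add' v v' := by funext d; simp [mul_add]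
  map_smul' a v := by funext d; simp [mul_left_comm]
  invFun v d := ((w d)⁻¹ : kˣ) * v (d - 1)
  left_inv v := by funext d; simp
  right_inv v := by funext d; simp

lemma weightedShift_single (w : ZMod N → kˣ) (c : ZMod N) :
    weightedShift w (Pi.single c (1 : k)) = (w c : k) • Pi.single (c - 1) (1 : k) := by
  funext d
  by_cases h : d + 1 = c
  · subst h; simp [weightedShift]
  · have h' : d ≠ c - 1 := fun e => h (by simp [e])
    simp [weightedShift, h, h']

/-- The matrix `θ_{ic} = Q_{i-1,c} Q_{i,c-1} / (Q_{ic} Q_{i-1,c-1})`. -/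
def theta (Q : ZMod M → ZMod N → kˣ) (i : ZMod M) (c : ZMod N) : kˣ :=
  (Q (i - 1) c * Q i (c - 1)) / (Q i c * Q (i - 1) (c - 1))

lemma theta_eq (Q : ZMod M → ZMod N → kˣ) (i : ZMod M) (c : ZMod N) :
    theta Q i c = (Q (i - 1) c / Q i c) / (Q (i - 1) (c - 1) / Q i (c - 1)) := by
  rw [theta, div_div_div_eq]

lemma weightedShift_theta_pow (Q : ZMod M → ZMod N → kˣ) (i : ZMod M) (n : ℕ)
    (v : ZMod N → k) (d : ZMod N) :
    (weightedShift (theta Q i) ^ n) v d =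
      (((Q (i - 1) (d + n) / Q i (d + n)) / (Q (i - 1) d / Q i d) : kˣ) : k) * v (d + n) := by
  induction n generalizing d with
  | zero => simp
  | succ n ih =>
    rw [pow_succ', LinearEquiv.mul_apply]
    change (theta Q i (d + 1) : k) * _ = _
    rw [ih, ← mul_assoc, ← Units.val_mul, theta_eq]
    have e : d + 1 + (n : ZMod N) = d + ((n + 1 : ℕ) : ZMod N) := by push_cast; ring
    rw [e, add_sub_cancel_right, mul_comm (_ / _ : kˣ),
      div_mul_div_cancel]

lemma weightedShift_list (W : List (ZMod N → kˣ)) :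
    ∃ u : ZMod N → k, ∀ (v : ZMod N → k) (d : ZMod N),
      (W.map weightedShift).prod v d = u d * v (d + W.length) := by
  induction W with
  | nil => exact ⟨1, fun v d => by simp⟩
  | cons w W ih =>
    obtain ⟨u, hu⟩ := ih
    refine ⟨fun d => w (d + 1) * u (d + 1), fun v d => ?_⟩
    rw [List.map_cons, List.prod_cons, LinearEquiv.mul_apply]
    change (w (d + 1) : k) * _ = _
    rw [hu, ← mul_assoc]
    congr 2
    simp only [List.length_cons]
    push_cast
    ring

lemma weightedShift_commute (w w' : Fin N → ZMod N → kˣ) :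
    Commute (List.ofFn fun a => weightedShift (w a)).prod
      (List.ofFn fun a => weightedShift (w' a)).prod := by
  have key : ∀ w : Fin N → ZMod N → kˣ, ∃ u : ZMod N → k, ∀ (v : ZMod N → k) (d : ZMod N),
      (List.ofFn fun a => weightedShift (w a)).prod v d = u d * v d := by
    intro w
    obtain ⟨u, hu⟩ := weightedShift_list (List.ofFn w)
    refine ⟨u, fun v d => ?_⟩
    have := hu v d
    simpa [List.map_ofFn, Function.comp_def] using this
  obtain ⟨u, hu⟩ := key w
  obtain ⟨u', hu'⟩ := key w'
  refine LinearEquiv.ext fun v => funext fun d => ?_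
  rw [LinearEquiv.mul_apply, LinearEquiv.mul_apply, hu, hu', hu', hu, mul_left_comm]

/-- The restriction of `ρ_Q` to `Γ_{M,N}`: the generator `g_i` maps `ε_c` to `θ_{ic} ε_{c-1}`. -/
def rhoGamma (Q : ZMod M → ZMod N → kˣ) : Gamma M N →* ((ZMod N → k) ≃ₗ[k] (ZMod N → k)) :=
  Gamma.lift (fun i => weightedShift (theta Q i))
    (fun i => LinearEquiv.ext fun v => funext fun d => by simp [weightedShift_theta_pow])
    (fun _ _ => weightedShift_commute _ _)

lemma rhoQ_commute (Q : ZMod M → ZMod N → kˣ) (r : Gamma M N) (f : Multiplicative (ZMod M) → k) :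
    Commute
      (((LinearEquiv.automorphismGroup.toLinearMapMonoidHom).comp (rhoGamma Q)) r)
      (((Algebra.ofId k (Module.End k (ZMod N → k))).comp
        (Pi.evalAlgHom k (fun _ : Multiplicative (ZMod M) => k) (Multiplicative.ofAdd 1))) f) :=
  Algebra.commute_algebraMap_right (A := Module.End k (ZMod N → k)) (f (Multiplicative.ofAdd 1)) _

/-- The representation `ρ_Q : k[Γ_{M,N}] ⋊ k^{ℤ/M} → End(k^N)` with
`ρ_Q(g_i # 1)(ε_c) = θ_{ic} ε_{c-1}` and `ρ_Q(1 # f) = f(h) id`, where `h` is the generator `1` of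
`ℤ/M`. -/
def rhoQ (Q : ZMod M → ZMod N → kˣ) :
    SmashCoproduct k (Gamma M N) (Multiplicative (ZMod M)) →ₐ[k] Module.End k (ZMod N → k) :=
  SmashCoproduct.algLift
    ((LinearEquiv.automorphismGroup.toLinearMapMonoidHom).comp (rhoGamma Q))
    ((Algebra.ofId k (Module.End k (ZMod N → k))).comp
      (Pi.evalAlgHom k (fun _ : Multiplicative (ZMod M) => k) (Multiplicative.ofAdd 1)))
    (rhoQ_commute Q)

/-- `ρ_Q(g_i # 1)(ε_c) = θ_{ic} ε_{c-1}`. -/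
theorem rhoQ_g (Q : ZMod M → ZMod N → kˣ) (i : ZMod M) (c : ZMod N) :
    rhoQ Q (SmashCoproduct.elt (Gamma.g i) 1) (Pi.single c (1 : k)) =
      (theta Q i c : k) • Pi.single (c - 1) (1 : k) := by
  rw [rhoQ, SmashCoproduct.algLift_elt, map_one, mul_one]
  change rhoGamma Q (Gamma.g i) _ = _
  rw [rhoGamma, Gamma.lift_g, weightedShift_single]

/-- `ρ_Q(1 # f) = f(h) id`. -/
theorem rhoQ_fun (Q : ZMod M → ZMod N → kˣ) (f : Multiplicative (ZMod M) → k) :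
    rhoQ Q (SmashCoproduct.elt 1 f) = f (Multiplicative.ofAdd 1) • LinearMap.id := by
  rw [rhoQ, SmashCoproduct.algLift_elt, map_one, one_mul]
  rfl

end Representation

end

/-!
The functionals `r # f ↦ F r * f y` which factor through a given Hopf quotient of the smash
coproduct form, as `y` varies, a family closed under convolution, and the quotient is trivial as
soon as those with `y = 1` separate the points of `Γ_{M,N}`. The matrix coefficients of `ρ_Q` belong
to this family, with `y` the generator of `ℤ/M`. Their products separate all points, unless some
`t ≠ 1` of degree `0` acts on `k^N`, together with its translates under `ℤ/M`, by scalars of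
determinant `1`, hence with finite order. The elements acting with finite order form a submodule of
the degree `0` part of `Γ_{M,N}`, which is abelian. If `p` is the prime among `M` and `N`, this part
is a cyclic module over `ℤ[ζ_p]`, generated by `g_1 g_0⁻¹`: a nonzero submodule contains a nonzero
integer multiple of the generator, and then all the `θ_{ic}` are roots of unity.
-/

noncomputable section

theorem InnerFaithful.of_injective {k A R : Type*} [Field k] [Ring A]
    [HopfAlgebra k A] [Ring R] [Algebra k R] {ρ : A →ₐ[k] R}
    (h : ∀ G : HopfFactorization ρ, Function.Injective G.q) : InnerFaithful ρ := by
  intro G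
  let e : A ≃ₐc[k] G.L := BialgEquiv.ofBijective G.q ⟨h G, G.surjective_q⟩
  have he : ∀ a, e.symm (G.q a) = a := e.symm_apply_apply
  refine ⟨(e.symm : G.L →ₐc[k] A), ⟨he, fun x => ?_⟩, fun f hf => ?_⟩
  · obtain ⟨a, rfl⟩ := G.surjective_q x
    exact (congrArg ρ (he a)).trans (G.fac a).symm
  · refine BialgHom.ext fun x => ?_
    obtain ⟨a, rfl⟩ := G.surjective_q x
    exact (hf.1 a).trans (he a).symm

/-! ### Functionals factoring through a quotient of a smash coproduct -/

namespace SmashCoproduct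

open WithConv

variable {k Γ H : Type*} [Field k] [Group Γ] [Group H]

/-- The linear functional `r # f ↦ F r * f y` on the smash coproduct, as a linear function of
`F : Γ → k`. As `y` varies, these functionals are closed under convolution. -/
def functional (y : H) : (Γ → k) →ₗ[k] Module.Dual k (SmashCoproduct k Γ H) where
  toFun F := linLift fun r => F r • LinearMap.proj y
  map_add' F G := linearMap_ext fun r f => by simp [linLift_elt, add_mul]
  map_smul' c F := linearMap_ext fun r f => by simp [linLift_elt, mul_assoc]

lemma functional_elt (y : H) (F : Γ → k) (r : Γ) (f : H → k) :
    functional y F (elt r f) = F r * f y :=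
  (linLift_elt _ r f).trans rfl

lemma exists_eq_sum_elt (a : SmashCoproduct k Γ H) :
    ∃ f : Γ →₀ (H → k), a = ∑ r ∈ f.support, elt r (f r) := by
  let Ψ : (Γ →₀ (H → k)) →ₗ[k] SmashCoproduct k Γ H := Finsupp.lsum k eltLin
  have hΨ : (LinearMap.range Ψ).mkQ = 0 := linearMap_ext fun r f => by
    rw [LinearMap.zero_apply, Submodule.mkQ_apply, Submodule.Quotient.mk_eq_zero]
    exact ⟨Finsupp.single r f, Finsupp.sum_single_index (map_zero (eltLin r))⟩
  have ha : a ∈ LinearMap.range Ψ := by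
    rw [← Submodule.ker_mkQ (LinearMap.range Ψ), hΨ, LinearMap.ker_zero]
    trivial
  obtain ⟨f, rfl⟩ := ha
  exact ⟨f, rfl⟩

variable [Fintype H] [DecidableEq H] [MulDistribMulAction H Γ]

lemma functional_convMul (y z : H) (F G : Γ → k) :
    toConv (functional y F) * toConv (functional z G) =
      toConv (functional (y * z) fun r => F r * G (y⁻¹ • r)) := by
  refine WithConv.ext (linearMap_ext_single fun r x => ?_)
  simp only [LinearMap.convMul_def, ofConv_toConv, LinearMap.comp_apply, comul_elt_single, map_sum,
    TensorProduct.map_tmul, LinearMap.mul'_apply, functional_elt]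
  rw [Fintype.sum_eq_single y fun l hl => by simp [hl.symm]]
  simp [Pi.single_apply, eq_inv_mul_iff_mul_eq]

lemma functional_one :
    functional 1 1 = (Coalgebra.counit : SmashCoproduct k Γ H →ₗ[k] k) :=
  linearMap_ext fun r f => by simp [counit_eq, counitLin_elt, functional_elt]

variable {L : Type*} [AddCommGroup L] [Module k L] [Coalgebra k L]
  (q : SmashCoproduct k Γ H →ₗc[k] L)

/-- The functions `F` on `Γ` for which the functional `r # f ↦ F r * f y` factors through `q`. -/
def descending (y : H) : Submodule k (Γ → k) :=
  (LinearMap.range (Module.Dual.transpose (R := k) q.toLinearMap)).comap (functional y)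

variable {q}

lemma mem_descending {y : H} {F : Γ → k} :
    F ∈ descending q y ↔ ∃ μ : Module.Dual k L, μ ∘ₗ q.toLinearMap = functional y F :=
  Iff.rfl

lemma mul_mem_descending {y z : H} {F G : Γ → k} (hF : F ∈ descending q y)
    (hG : G ∈ descending q z) : (fun r => F r * G (y⁻¹ • r)) ∈ descending q (y * z) := by
  obtain ⟨μ, hμ⟩ := mem_descending.1 hF
  obtain ⟨ν, hν⟩ := mem_descending.1 hG
  refine mem_descending.2 ⟨(toConv μ * toConv ν).ofConv, ?_⟩
  rw [LinearMap.convMul_comp_coalgHom_distrib]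
  simp only [ofConv_toConv, hμ, hν, functional_convMul]

lemma one_mem_descending : (1 : Γ → k) ∈ descending q (1 : H) :=
  mem_descending.2 ⟨Coalgebra.counit, by rw [functional_one]; exact q.counit_comp⟩

lemma mul_mem_descending_of_one {y : H} {F G : Γ → k} (hF : F ∈ descending q (1 : H))
    (hG : G ∈ descending q y) : F * G ∈ descending q y := by
  have h := mul_mem_descending hF hG
  simp only [one_mul, inv_one, one_smul] at h
  exact h

variable (q) in
/-- The functions descending at `1 : H` form an algebra, for the pointwise product. -/
def descendingSubalgebra : Subalgebra k (Γ → k) :=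
  (descending q (1 : H)).toSubalgebra one_mem_descending fun _ _ => mul_mem_descending_of_one

/-- Evaluations at distinct points of `Γ` are distinct characters of the algebra of functions
descending at `1`, and distinct characters are linearly independent. -/
theorem injective_of_descending
    (separates : (descending q (1 : H) : Set (Γ → k)).SeparatesPoints)
    (nonvanishing : ∀ (y : H) (r : Γ), ∃ F ∈ descending q y, F r ≠ 0) :
    Function.Injective q := by
  let B := descendingSubalgebra q
  let ev (r : Γ) : B →* k := (Pi.evalMonoidHom (fun _ => k) r).comp B.toSubmonoid.subtype
  have ev_injective : Function.Injective ev := fun r s hrs => by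
    by_contra hne
    obtain ⟨F, hF, hFrs⟩ := separates hne
    exact hFrs (DFunLike.congr_fun hrs ⟨F, hF⟩)
  have ev_indep := (linearIndependent_monoidHom B k).comp ev ev_injective
  rw [injective_iff_map_eq_zero]
  intro a ha
  obtain ⟨f, rfl⟩ := exists_eq_sum_elt a
  suffices h : ∀ r ∈ f.support, f r = 0 from
    Finset.sum_eq_zero fun r hr => by rw [h r hr, elt_zero]
  intro r hr
  funext y
  obtain ⟨G, hG, hGr⟩ := nonvanishing y r
  have vanish (F : B) : ∑ s ∈ f.support, (G s * f s y) * ev s F = 0 := by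
    obtain ⟨μ, hμ⟩ := mem_descending.1 (mul_mem_descending_of_one F.2 hG)
    have h : μ (q _) = _ := LinearMap.congr_fun hμ (∑ s ∈ f.support, elt s (f s))
    rw [ha, map_zero, map_sum] at h
    refine Eq.trans (Finset.sum_congr rfl fun s _ => ?_) h.symm
    rw [functional_elt, Pi.mul_apply, mul_comm (F.1 s), mul_right_comm]
    rfl
  have h := linearIndependent_iff'.1 ev_indep f.support (fun s => G s * f s y)
    (funext fun F => by simpa using vanish F) r hr
  exact (mul_eq_zero.1 h).resolve_left hGr

end SmashCoproduct

/-! ### Submodules of cyclic modules over `R[X] ⧸ (g)` -/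

section CyclicModule

open Polynomial Module.End

variable {R : Type*} [CommRing R] {g : R[X]}

/-- A nonzero element of the domain `R[X] ⧸ (g)`, being integral over `R`, divides a nonzero
constant. -/
lemma dvd_or_exists_mul_add_mul_eq_C [Nontrivial R] (monic : g.Monic) (prime : Prime g) (f : R[X]) :
    g ∣ f ∨ ∃ a b m, m ≠ 0 ∧ a * f + b * g = C m := by
  refine or_iff_not_imp_left.2 fun hgf => ?_
  have : IsDomain (AdjoinRoot g) := AdjoinRoot.isDomain_of_prime prime
  have : Module.Finite R (AdjoinRoot g) := monic.finite_adjoinRoot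
  have hf : AdjoinRoot.mk g f ≠ 0 := mt AdjoinRoot.mk_eq_zero.1 hgf
  obtain ⟨m, hm, hm₀⟩ := Submodule.exists_mem_ne_zero_of_ne_bot <|
    Ideal.comap_ne_bot_of_integral_mem (R := R) hf (Ideal.mem_span_singleton_self _)
      (Algebra.IsIntegral.isIntegral _)
  obtain ⟨a', ha'⟩ := Ideal.mem_span_singleton'.1 hm
  obtain ⟨a, rfl⟩ := AdjoinRoot.mk_surjective a'
  obtain ⟨b, hb⟩ : g ∣ C m - a * f := AdjoinRoot.mk_eq_mk.1 <| by
    rw [map_mul, ha']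
    rfl
  exact ⟨a, b, m, hm₀, by linear_combination -hb⟩

variable {V : Type*} [AddCommGroup V] [Module R V] {τ : Module.End R V} {u : V}

lemma aeval_apply_mem {S : Submodule R V} (hS : S ∈ τ.invtSubmodule) (f : R[X]) {v : V}
    (hv : v ∈ S) : aeval τ f v ∈ S := by
  have h := (Module.AEval.mapSubmodule R V τ ⟨S, hS⟩).smul_mem f
    ((Module.AEval.mem_mapSubmodule_apply R V τ (m := Module.AEval.of R V τ v)).2 hv)
  simpa using (Module.AEval.mem_mapSubmodule_apply R V τ).1 h

lemma exists_aeval_apply_eq (cyclic : ∀ W ∈ τ.invtSubmodule, u ∈ W → W = ⊤) (v : V) :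
    ∃ f : R[X], aeval τ f u = v := by
  let W : Submodule R V := LinearMap.range (LinearMap.applyₗ u ∘ₗ (aeval τ).toLinearMap)
  suffices h : W = ⊤ from LinearMap.range_eq_top.1 h v
  refine cyclic W ?_ ⟨1, by simp⟩
  rintro _ ⟨f, rfl⟩
  exact ⟨X * f, by simp⟩

theorem eq_bot_of_smul_notMem [Nontrivial R] (monic : g.Monic) (prime : Prime g)
    (hu : aeval τ g u = 0) (cyclic : ∀ W ∈ τ.invtSubmodule, u ∈ W → W = ⊤) {S : Submodule R V}
    (hS : S ∈ τ.invtSubmodule) (smul_notMem : ∀ m : R, m ≠ 0 → m • u ∉ S) : S = ⊥ := by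
  refine (Submodule.eq_bot_iff S).2 fun v hv => ?_
  obtain ⟨f, rfl⟩ := exists_aeval_apply_eq cyclic v
  obtain ⟨b, rfl⟩ | ⟨a, b, m, hm, h⟩ := dvd_or_exists_mul_add_mul_eq_C monic prime f
  · rw [mul_comm, map_mul, Module.End.mul_apply, hu, map_zero]
  · have hmu : aeval τ a (aeval τ f u) = m • u := by
      simpa [hu] using congrArg (fun f => aeval τ f u) h
    exact absurd (hmu ▸ aeval_apply_mem hS a hv) (smul_notMem m hm)

end CyclicModule

/-! ### The kernel of the degree on `Γ_{M,N}` -/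

namespace Gamma

variable {M N : ℕ}

lemma induction_mul_g [NeZero N] {P : Gamma M N → Prop} (one : P 1)
    (mul_g : ∀ r i, P r → P (r * g i)) (r : Gamma M N) : P r := by
  have isOfFinOrder_g : ∀ x ∈ Set.range (g : ZMod M → Gamma M N), IsOfFinOrder x := by
    rintro _ ⟨i, rfl⟩
    exact isOfFinOrder_iff_pow_eq_one.2 ⟨N, NeZero.pos N, g_pow i⟩
  have hr : r ∈ Submonoid.closure (Set.range (g : ZMod M → Gamma M N)) := by
    rw [← Subgroup.closure_toSubmonoid_of_isOfFinOrder isOfFinOrder_g]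
    change r ∈ Subgroup.closure (Set.range PresentedGroup.of)
    rw [PresentedGroup.closure_range_of]
    trivial
  induction hr using Submonoid.closure_induction_right with
  | one => exact one
  | mul_right x _ y hy ih =>
    obtain ⟨i, rfl⟩ := hy
    exact mul_g x i ih

/-- The degree `Γ_{M,N} → ℤ/N`, sending every generator to `1`. -/
def deg : Gamma M N →* Multiplicative (ZMod N) :=
  lift (fun _ => Multiplicative.ofAdd 1) (fun _ => by
    rw [← ofAdd_nsmul, nsmul_one, ZMod.natCast_self, ofAdd_zero]) (fun _ _ => Commute.all _ _)

@[simp] lemma deg_g (i : ZMod M) : deg (g i : Gamma M N) = Multiplicative.ofAdd 1 := lift_g ..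

@[simp] lemma deg_smul [NeZero N] (a : Multiplicative (ZMod M)) (r : Gamma M N) :
    deg (a • r) = deg r := by
  induction r using induction_mul_g with
  | one => rw [smul_one]
  | mul_g r i ih => rw [smul_mul', map_mul, map_mul, ih, smul_g, deg_g, deg_g]

lemma g_pow_val_natCast (i : ZMod M) (n : ℕ) :
    (g i : Gamma M N) ^ (n : ZMod N).val = g i ^ n := by
  rw [ZMod.val_natCast, ← pow_eq_pow_mod n (g_pow i)]

/-- Schreier's lemma for the transversal `{g_0 ^ d}`. -/
lemma ker_deg_le [NeZero N] {K : Subgroup (Gamma M N)}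
    (hK : ∀ i, ∀ d < N, g 0 ^ d * (g i * (g 0)⁻¹) * (g 0 ^ d)⁻¹ ∈ K) :
    (deg : Gamma M N →* _).ker ≤ K := by
  have mem (r : Gamma M N) : r * (g 0 ^ (deg r).toAdd.val)⁻¹ ∈ K := by
    induction r using induction_mul_g with
    | one => simp
    | mul_g r i ih =>
      set d := (deg r).toAdd
      have hd : g 0 ^ (deg (r * g i)).toAdd.val = (g 0 : Gamma M N) ^ (d.val + 1) := by
        rw [← g_pow_val_natCast 0 (d.val + 1), map_mul, deg_g, toAdd_mul, toAdd_ofAdd,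
          Nat.cast_succ, ZMod.natCast_zmod_val]
      rw [hd]
      convert K.mul_mem ih (hK i d.val d.val_lt) using 1
      group
  intro r hr
  simpa [MonoidHom.mem_ker.1 hr] using mem r

lemma exists_word_eq_conj {d : ℕ} (hd : d < N) (i : ZMod M) : ∃ w : Fin N → ZMod M,
    (List.ofFn fun a => (g (w a) : Gamma M N)).prod =
      g 0 ^ d * (g i * (g 0)⁻¹) * (g 0 ^ d)⁻¹ := by
  obtain ⟨e, rfl⟩ : ∃ e, N = d + 1 + e := ⟨N - (d + 1), by omega⟩
  let w : Fin (d + 1 + e) → ZMod M :=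
    Fin.append (Fin.append (fun _ : Fin d => 0) fun _ : Fin 1 => i) fun _ : Fin e => 0
  have hw : List.ofFn (fun a => (g (w a) : Gamma M (d + 1 + e))) = (List.ofFn w).map g := by
    simp [List.map_ofFn, Function.comp_def]
  have he : (g 0 : Gamma M (d + 1 + e)) ^ e = (g 0 ^ (d + 1))⁻¹ := by
    rw [eq_inv_iff_mul_eq_one, ← pow_add, add_comm e, g_pow]
  refine ⟨w, ?_⟩
  rw [hw, List.ofFn_fin_append, List.ofFn_fin_append]
  simp [List.ofFn_const, he, pow_succ, mul_assoc]

lemma commute_of_deg_eq_one [NeZero N] {s t : Gamma M N} (hs : deg s = 1) (ht : deg t = 1) :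
    Commute s t := by
  let V : Set (Gamma M N) :=
    {x | ∃ i, ∃ d < N, x = g 0 ^ d * (g i * (g 0)⁻¹) * (g 0 ^ d)⁻¹}
  have commute_V : ∀ x ∈ V, ∀ y ∈ V, x * y = y * x := by
    rintro _ ⟨i, d, hd, rfl⟩ _ ⟨j, e, he, rfl⟩
    obtain ⟨w, hw⟩ := exists_word_eq_conj hd i
    obtain ⟨w', hw'⟩ := exists_word_eq_conj he j
    rw [← hw, ← hw', g_commute w w']
  have hle : (deg : Gamma M N →* _).ker ≤ Subgroup.closure V :=
    ker_deg_le fun i d hd => Subgroup.subset_closure ⟨i, d, hd, rfl⟩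
  have := Subgroup.isMulCommutative_closure commute_V
  exact congrArg Subtype.val (mul_comm' (⟨s, hle hs⟩ : Subgroup.closure V) ⟨t, hle ht⟩)

instance [NeZero N] : CommGroup (deg : Gamma M N →* _).ker where
  mul_comm s t := Subtype.ext (commute_of_deg_eq_one s.2 t.2)

/-- The kernel of the degree, written additively. -/
abbrev KerDeg (M N : ℕ) : Type := Additive (deg : Gamma M N →* _).ker

/-- The element `g_i g_0⁻¹` of the kernel of the degree. -/
def diff (i : ZMod M) : KerDeg M N := Additive.ofMul ⟨g i * (g 0)⁻¹, by simp [MonoidHom.mem_ker]⟩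

lemma coe_diff (i : ZMod M) : ((diff i : KerDeg M N).toMul : Gamma M N) = g i * (g 0)⁻¹ := rfl

lemma diff_zero : (diff 0 : KerDeg M N) = 0 :=
  Subtype.ext (mul_inv_cancel _)

variable [NeZero N]

/-- The restriction to the kernel of the degree of an endomorphism of `Γ_{M,N}` which preserves
the degree. -/
def kerDegEnd (φ : Gamma M N →* Gamma M N) (hφ : ∀ r, deg (φ r) = deg r) :
    Module.End ℤ (KerDeg M N) :=
  (MonoidHom.toAdditive ((φ.comp (Subgroup.subtype _)).codRestrict (deg : Gamma M N →* _).ker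
    fun t => (hφ t).trans t.2)).toIntLinearMap

/-- Conjugation by `g_0` on the kernel of the degree. -/
def conjEnd (M N : ℕ) [NeZero N] : Module.End ℤ (KerDeg M N) :=
  kerDegEnd (MulAut.conj (g 0)).toMonoidHom fun r => by simp [mul_inv_cancel_comm]

/-- The action of the generator of `ℤ/M` on the kernel of the degree. -/
def shiftEnd (M N : ℕ) [NeZero N] : Module.End ℤ (KerDeg M N) :=
  kerDegEnd (MulDistribMulAction.toMonoidHom _ (Multiplicative.ofAdd (1 : ZMod M)))
    fun r => deg_smul _ r

lemma coe_conjEnd (v : KerDeg M N) :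
    ((conjEnd M N v).toMul : Gamma M N) = g 0 * (v.toMul : Gamma M N) * (g 0)⁻¹ := rfl

lemma coe_shiftEnd (v : KerDeg M N) :
    ((shiftEnd M N v).toMul : Gamma M N) =
      Multiplicative.ofAdd (1 : ZMod M) • (v.toMul : Gamma M N) := rfl

lemma coe_conjEnd_pow (n : ℕ) (v : KerDeg M N) :
    (((conjEnd M N ^ n) v).toMul : Gamma M N) = g 0 ^ n * (v.toMul : Gamma M N) * (g 0 ^ n)⁻¹ := by
  induction n with
  | zero => simp
  | succ n ih =>
    rw [pow_succ', Module.End.mul_apply, coe_conjEnd, ih]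
    group

lemma coe_geom_sum_conjEnd_diff (n : ℕ) (i : ZMod M) :
    (((∑ j ∈ Finset.range n, conjEnd M N ^ j) (diff i)).toMul : Gamma M N) =
      g i ^ n * (g 0 ^ n)⁻¹ := by
  induction n with
  | zero => simp
  | succ n ih =>
    rw [geom_sum_succ', LinearMap.add_apply, add_comm, toMul_add, Subgroup.coe_mul, ih,
      coe_conjEnd_pow, coe_diff]
    group

lemma geom_sum_conjEnd_diff (i : ZMod M) :
    (∑ j ∈ Finset.range N, conjEnd M N ^ j) (diff i) = 0 :=
  Subtype.ext <| (coe_geom_sum_conjEnd_diff N i).trans <| by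
    rw [g_pow, g_pow, inv_one, mul_one]
    rfl

lemma shiftEnd_diff (i : ZMod M) : shiftEnd M N (diff i) = diff (i + 1) - diff 1 :=
  Subtype.ext <| by
    change Multiplicative.ofAdd (1 : ZMod M) • (g i * (g 0)⁻¹ : Gamma M N) =
      g (i + 1) * (g 0)⁻¹ / (g 1 * (g 0)⁻¹)
    rw [smul_mul', smul_inv', smul_g, smul_g, toAdd_ofAdd, zero_add, mul_div_mul_right_eq_div,
      div_eq_mul_inv]

lemma geom_sum_shiftEnd_diff (n : ℕ) :
    (∑ j ∈ Finset.range n, shiftEnd M N ^ j) (diff 1) = diff (n : ZMod M) := by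
  induction n with
  | zero => simp [diff_zero]
  | succ n ih =>
    rw [geom_sum_succ, LinearMap.add_apply, Module.End.mul_apply, ih, shiftEnd_diff,
      Module.End.one_apply, sub_add_cancel, Nat.cast_succ]

lemma submodule_eq_top_of_conjEnd_pow_diff_mem {W : Submodule ℤ (KerDeg M N)}
    (hW : ∀ i, ∀ d < N, (conjEnd M N ^ d) (diff i) ∈ W) : W = ⊤ := by
  have hle : (deg : Gamma M N →* _).ker ≤
      (AddSubgroup.toSubgroup' W.toAddSubgroup).map (Subgroup.subtype _) :=
    ker_deg_le fun i d hd => ⟨_, hW i d hd, coe_conjEnd_pow d (diff i)⟩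
  refine eq_top_iff.2 fun v _ => ?_
  obtain ⟨w, hw, hwv⟩ := hle v.toMul.2
  rwa [← show w = v from Subtype.ext hwv]

open Module.End in
lemma eq_top_of_mem_invtSubmodule_conjEnd {W : Submodule ℤ (KerDeg 2 N)}
    (hW : W ∈ invtSubmodule (conjEnd 2 N)) (hdiff : diff 1 ∈ W) : W = ⊤ := by
  refine submodule_eq_top_of_conjEnd_pow_diff_mem fun i d _ =>
    pow_apply_mem_of_forall_mem d hW _ ?_
  obtain rfl | rfl : i = 0 ∨ i = 1 := by revert i; decide
  · rw [diff_zero]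
    exact W.zero_mem
  · exact hdiff

open Module.End in
lemma eq_top_of_mem_invtSubmodule_shiftEnd [NeZero M] {W : Submodule ℤ (KerDeg M 2)}
    (hW : W ∈ invtSubmodule (shiftEnd M 2)) (hdiff : diff 1 ∈ W) : W = ⊤ := by
  have diff_mem (i : ZMod M) : diff i ∈ W := by
    rw [← ZMod.natCast_zmod_val i, ← geom_sum_shiftEnd_diff, LinearMap.sum_apply]
    exact W.sum_mem fun j _ => pow_apply_mem_of_forall_mem j hW _ hdiff
  have conjEnd_diff (i : ZMod M) : conjEnd M 2 (diff i) = -diff i := by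
    have h := geom_sum_conjEnd_diff (N := 2) i
    rw [geom_sum_two, LinearMap.add_apply, Module.End.one_apply] at h
    exact eq_neg_of_add_eq_zero_left h
  refine submodule_eq_top_of_conjEnd_pow_diff_mem fun i d hd => ?_
  interval_cases d
  · exact diff_mem i
  · rw [pow_one, conjEnd_diff]
    exact W.neg_mem (diff_mem i)

end Gamma

/-! ### Roots of unity among the `θ_{ic}` -/

section Theta

lemma prod_div_apply_sub_one {A : Type*} [CommGroup A] {n : ℕ} [NeZero n] (f : ZMod n → A) :
    ∏ c, f c / f (c - 1) = 1 := by
  have shift : ∏ c, f (c - 1) = ∏ c, f c := Equiv.prod_comp (Equiv.subRight 1) f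
  rw [Finset.prod_div_distrib, shift, div_self']

lemma mem_of_zero_mem_of_div_mem {A : Type*} [Group A] {n : ℕ} [NeZero n] {T : Subgroup A}
    {f : ZMod n → A} (zero_mem : f 0 ∈ T) (div_mem : ∀ i, f (i + 1) / f i ∈ T) (i : ZMod n) :
    f i ∈ T := by
  rw [← ZMod.natCast_zmod_val i]
  induction i.val with
  | zero => rwa [Nat.cast_zero]
  | succ m ih =>
    rw [Nat.cast_succ, ← div_mul_cancel (f (m + 1)) (f m)]
    exact T.mul_mem (div_mem m) ih

variable {k : Type*} [Field k] {M N : ℕ} {Q : ZMod M → ZMod N → kˣ}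

lemma prod_theta_row [NeZero N] (i : ZMod M) : ∏ c, theta Q i c = 1 := by
  simp only [theta_eq]
  exact prod_div_apply_sub_one fun c => Q (i - 1) c / Q i c

variable [NeZero M]

lemma prod_theta_col (c : ZMod N) : ∏ i, theta Q i c = 1 := by
  rw [← prod_div_apply_sub_one fun i => Q i (c - 1) / Q i c]
  refine Finset.prod_congr rfl fun i _ => ?_
  rw [theta, div_div_div_eq, mul_comm (Q (i - 1) c)]

lemma isOfFinOrder_theta_of_div
    (h : ∀ i c, IsOfFinOrder (theta Q (i + 1) c / theta Q i c)) (i : ZMod M) (c : ZMod N) :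
    IsOfFinOrder (theta Q i c) := by
  have div_mem (j : ZMod M) : theta Q j c / theta Q 0 c ∈ CommGroup.torsion kˣ :=
    mem_of_zero_mem_of_div_mem (f := fun j => theta Q j c / theta Q 0 c)
      (by simp [one_mem]) (fun j => by rw [div_div_div_cancel_right]; exact h j c) j
  have hpow : theta Q 0 c ^ M ∈ CommGroup.torsion kˣ := by
    simpa [Finset.prod_div_distrib, prod_theta_col] using
      prod_mem (t := Finset.univ) fun j _ => div_mem j
  rw [← div_mul_cancel (theta Q i c) (theta Q 0 c)]
  exact mul_mem (div_mem i) (IsOfFinOrder.of_pow hpow (NeZero.ne M))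

lemma exists_not_isOfFinOrder_theta [NeZero N] (hQ₀ : ∀ c, Q 0 c = 1) (hQ₁ : ∀ i, Q i 0 = 1)
    (hQ : ∃ i c, ¬ IsOfFinOrder (Q i c)) : ∃ i c, ¬ IsOfFinOrder (theta Q i c) := by
  contrapose! hQ with hθ
  have div_mem (i : ZMod M) (c : ZMod N) : Q i c / Q (i + 1) c ∈ CommGroup.torsion kˣ :=
    mem_of_zero_mem_of_div_mem (f := fun c => Q i c / Q (i + 1) c) (by simp [hQ₁, one_mem])
      (fun c => by
        have h := hθ (i + 1) (c + 1)
        rwa [theta_eq, add_sub_cancel_right, add_sub_cancel_right] at h) c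
  refine fun i c => mem_of_zero_mem_of_div_mem (T := CommGroup.torsion kˣ) (f := fun i => Q i c)
    (by simp [hQ₀, one_mem]) (fun i => ?_) i
  rw [← inv_div]
  exact inv_mem (div_mem i c)

end Theta

/-! ### Weights of the representations `ρ_Q` -/

section Weight

open Gamma Multiplicative

variable {k : Type*} [Field k] {M N : ℕ} (Q : ZMod M → ZMod N → kˣ)

/-- The nonzero entry in row `d` of the monomial matrix through which `r` acts on `k^N`. -/
def weight (r : Gamma M N) (d : ZMod N) : k := rhoGamma Q r 1 d

lemma rhoGamma_g (i : ZMod M) (v : ZMod N → k) (d : ZMod N) :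
    rhoGamma Q (g i) v d = theta Q i (d + 1) * v (d + 1) := by
  rw [rhoGamma, lift_g]; rfl

lemma weight_g (i : ZMod M) (d : ZMod N) : weight Q (g i) d = theta Q i (d + 1) := by
  rw [weight, rhoGamma_g, Pi.one_apply, mul_one]

@[simp] lemma weight_one (d : ZMod N) : weight Q 1 d = 1 := by simp [weight]

variable [NeZero N]

lemma rhoGamma_apply (r : Gamma M N) (v : ZMod N → k) (d : ZMod N) :
    rhoGamma Q r v d = weight Q r d * v (d + (deg r).toAdd) := by
  suffices h : ∃ w : ZMod N → k, ∀ v d, rhoGamma Q r v d = w d * v (d + (deg r).toAdd) by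
    obtain ⟨w, hw⟩ := h
    rw [weight, hw, hw, Pi.one_apply, mul_one]
  induction r using induction_mul_g with
  | one => exact ⟨1, fun v d => by simp⟩
  | mul_g r i ih =>
    obtain ⟨w, hw⟩ := ih
    refine ⟨fun d => w d * theta Q i (d + (deg r).toAdd + 1), fun v d => ?_⟩
    rw [map_mul, LinearEquiv.mul_apply, hw, rhoGamma_g, map_mul, deg_g, toAdd_mul, toAdd_ofAdd,
      mul_assoc, add_assoc]

lemma weight_mul (r s : Gamma M N) (d : ZMod N) :
    weight Q (r * s) d = weight Q r d * weight Q s (d + (deg r).toAdd) := by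
  rw [weight, map_mul, LinearEquiv.mul_apply, rhoGamma_apply]
  rfl

lemma weight_ne_zero (r : Gamma M N) (d : ZMod N) : weight Q r d ≠ 0 := by
  have h := weight_mul Q r r⁻¹ d
  rw [mul_inv_cancel, weight_one] at h
  exact left_ne_zero_of_mul (h ▸ one_ne_zero)

lemma prod_weight (r : Gamma M N) : ∏ d, weight Q r d = 1 := by
  induction r using induction_mul_g with
  | one => simp
  | mul_g r i ih =>
    simp only [weight_mul, weight_g, Finset.prod_mul_distrib, ih, one_mul, add_assoc]
    refine (Equiv.prod_comp (Equiv.addRight ((deg r).toAdd + 1))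
      fun c => (theta Q i c : k)).trans ?_
    rw [← Units.coe_prod, prod_theta_row, Units.val_one]

/-- The character `t ↦ weight Q (a • t) d` of the kernel of the degree. -/
def weightHom (a : Multiplicative (ZMod M)) (d : ZMod N) : (deg : Gamma M N →* _).ker →* kˣ :=
  MonoidHom.toHomUnits
    { toFun t := weight Q (a • (t : Gamma M N)) d
      map_one' := by simp
      map_mul' s t := by
        have hs : deg (s : Gamma M N) = 1 := s.2
        rw [Subgroup.coe_mul, smul_mul', weight_mul, deg_smul, hs, toAdd_one, add_zero] }

variable {Q}

lemma coe_weightHom (a : Multiplicative (ZMod M)) (d : ZMod N) (t : (deg : Gamma M N →* _).ker) :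
    (weightHom Q a d t : k) = weight Q (a • (t : Gamma M N)) d := rfl

lemma weightHom_diff_one (a : Multiplicative (ZMod M)) (d : ZMod N) :
    weightHom Q a d (diff 1).toMul =
      theta Q (a.toAdd + 1) (d + 1) / theta Q a.toAdd (d + 1) := by
  rw [eq_div_iff_mul_eq']
  ext
  have h := weight_mul Q (a • (g 1 * (g 0)⁻¹ : Gamma M N)) (a • g 0) d
  rw [← smul_mul', inv_mul_cancel_right] at h
  simpa [smul_g, weight_g, coe_weightHom, coe_diff, add_comm, mul_comm] using h.symm

lemma weightHom_conjEnd (a : Multiplicative (ZMod M)) (d : ZMod N) (v : KerDeg M N) :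
    weightHom Q a d (conjEnd M N v).toMul = weightHom Q a (d + 1) v.toMul := by
  ext
  have h := weight_mul Q (a • (g 0 * (v.toMul : Gamma M N) * (g 0)⁻¹)) (a • g 0) d
  rw [← smul_mul', inv_mul_cancel_right, smul_mul', weight_mul, deg_smul, deg_smul, deg_g] at h
  have hdeg : deg (g 0 * (v.toMul : Gamma M N) * (g 0)⁻¹) = 1 := (conjEnd M N v).toMul.2
  rw [hdeg, toAdd_one, add_zero, mul_comm] at h
  exact mul_right_cancel₀ (weight_ne_zero Q _ d) h.symm

lemma weightHom_shiftEnd (a : Multiplicative (ZMod M)) (d : ZMod N) (v : KerDeg M N) :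
    weightHom Q a d (shiftEnd M N v).toMul = weightHom Q (a * ofAdd 1) d v.toMul := by
  ext
  rw [coe_weightHom, coe_weightHom, coe_shiftEnd, smul_smul]

/-- `a • t` acts as a scalar matrix of determinant `1`. -/
lemma isOfFinOrder_weightHom {a : Multiplicative (ZMod M)} {t : (deg : Gamma M N →* _).ker}
    (h : ∀ d, weightHom Q a d t = weightHom Q a 0 t) (d : ZMod N) :
    IsOfFinOrder (weightHom Q a d t) := by
  refine isOfFinOrder_iff_pow_eq_one.2 ⟨N, NeZero.pos N, ?_⟩
  have hprod : ∏ c, weightHom Q a c t = 1 := by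
    ext
    rw [Units.coe_prod]
    exact prod_weight Q _
  simpa [h] using hprod

variable (Q) in
/-- The elements of the kernel of the degree all of whose translates under `ℤ/M` act on `k^N` with
finite order. -/
def torsionSubmodule : Submodule ℤ (KerDeg M N) :=
  AddSubgroup.toIntSubmodule <| Subgroup.toAddSubgroup <|
    ⨅ a, ⨅ d, (CommGroup.torsion kˣ).comap (weightHom Q a d)

lemma mem_torsionSubmodule {v : KerDeg M N} :
    v ∈ torsionSubmodule Q ↔ ∀ a d, IsOfFinOrder (weightHom Q a d v.toMul) := by
  change v.toMul ∈ (⨅ a, ⨅ d, (CommGroup.torsion kˣ).comap (weightHom Q a d)) ↔ _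
  simp only [Subgroup.mem_iInf]
  rfl

open Module.End

lemma torsionSubmodule_mem_invtSubmodule_conjEnd :
    torsionSubmodule Q ∈ invtSubmodule (conjEnd M N) := fun v hv =>
  mem_torsionSubmodule.2 fun a d =>
    weightHom_conjEnd (Q := Q) a d v ▸ mem_torsionSubmodule.1 hv a (d + 1)

lemma torsionSubmodule_mem_invtSubmodule_shiftEnd :
    torsionSubmodule Q ∈ invtSubmodule (shiftEnd M N) := fun v hv =>
  mem_torsionSubmodule.2 fun a d =>
    weightHom_shiftEnd (Q := Q) a d v ▸ mem_torsionSubmodule.1 hv (a * ofAdd 1) d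

end Weight

/-! ### Separation of points by the matrix coefficients of `ρ_Q` -/

section Separation

open Gamma Multiplicative SmashCoproduct

variable {k : Type*} [Field k] {M N : ℕ} {Q : ZMod M → ZMod N → kˣ}

variable (Q) in
/-- The matrix coefficient of `ρ_Q` in row `d` and column `d + j`, as a function on `Γ_{M,N}`. -/
def matrixCoeff (j : Multiplicative (ZMod N)) (d : ZMod N) (r : Gamma M N) : k :=
  rhoGamma Q r (Pi.single (d + j.toAdd) 1) d

lemma matrixCoeff_eq_ite [NeZero N] (j : Multiplicative (ZMod N)) (d : ZMod N) (r : Gamma M N) :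
    matrixCoeff Q j d r = if deg r = j then weight Q r d else 0 := by
  simp [matrixCoeff, rhoGamma_apply, Pi.single_apply]

lemma matrixCoeff_of_deg_eq [NeZero N] {j : Multiplicative (ZMod N)} {r : Gamma M N} (h : deg r = j)
    (d : ZMod N) : matrixCoeff Q j d r = weight Q r d := by
  rw [matrixCoeff_eq_ite, if_pos h]

variable [NeZero M] (G : HopfFactorization (rhoQ Q))

lemma matrixCoeff_mem_descending (j : Multiplicative (ZMod N)) (d : ZMod N) :
    matrixCoeff Q j d ∈ descending G.q.toCoalgHom (ofAdd 1) := by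
  refine mem_descending.2 ⟨LinearMap.proj d ∘ₗ
    LinearMap.applyₗ (Pi.single (d + j.toAdd) 1) ∘ₗ G.φ.toLinearMap, linearMap_ext fun r f => ?_⟩
  change G.φ (G.q (elt r f)) (Pi.single (d + j.toAdd) 1) d = _
  rw [G.fac, rhoQ, algLift_elt, functional_elt]
  change rhoGamma Q r (f (ofAdd 1) • Pi.single (d + j.toAdd) 1) d = _
  rw [map_smul, Pi.smul_apply, smul_eq_mul, mul_comm, matrixCoeff]

variable [NeZero N]

lemma exists_mem_descending_ne_zero (y : Multiplicative (ZMod M)) (j : Multiplicative (ZMod N)) :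
    ∃ F ∈ descending G.q.toCoalgHom y, ∀ r, deg r = j → F r ≠ 0 := by
  have hy : ofAdd (1 : ZMod M) ^ y.toAdd.val = y := by
    rw [← ofAdd_nsmul, nsmul_one, ZMod.natCast_zmod_val, ofAdd_toAdd]
  rw [← hy]
  induction y.toAdd.val with
  | zero =>
    rw [pow_zero]
    exact ⟨1, one_mem_descending, fun r _ => one_ne_zero⟩
  | succ n ih =>
    obtain ⟨F, hF, hFj⟩ := ih
    rw [pow_succ]
    refine ⟨_, mul_mem_descending hF (matrixCoeff_mem_descending G j 0), fun r hr => ?_⟩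
    rw [matrixCoeff_of_deg_eq ((deg_smul _ r).trans hr)]
    exact mul_ne_zero (hFj r hr) (weight_ne_zero Q _ 0)

variable {G}

lemma deg_eq_of_forall_mem_descending {r s : Gamma M N}
    (h : ∀ F ∈ descending G.q.toCoalgHom 1, F r = F s) : deg r = deg s := by
  obtain ⟨F, hF, hFr⟩ := exists_mem_descending_ne_zero G (ofAdd 1)⁻¹ (deg r)
  have hrs := h _ (mul_inv_cancel (ofAdd (1 : ZMod M)) ▸
    mul_mem_descending (matrixCoeff_mem_descending G (deg r) 0) hF)
  by_contra hne
  simp [matrixCoeff_eq_ite, Ne.symm hne, weight_ne_zero, hFr] at hrs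

/-- If `F₁` and `F₂` descend at `a⁻¹` and at `h⁻¹ a`, where `h` is the generator of `ℤ/M`, then
`F₁ r * matrixCoeff Q j d (a • r) * F₂ (h⁻¹ • a • r)` descends at `1`, and only its middle factor
depends on `d`. -/
lemma weightHom_eq_of_forall_mem_descending {r : Gamma M N} {t : (deg : Gamma M N →* _).ker}
    (h : ∀ F ∈ descending G.q.toCoalgHom 1, F r = F (r * t)) (a : Multiplicative (ZMod M))
    (d d' : ZMod N) : weightHom Q a d t = weightHom Q a d' t := by
  have hrt : deg (r * (t : Gamma M N)) = deg r := by rw [map_mul, t.2, mul_one]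
  obtain ⟨F₁, hF₁, hF₁r⟩ := exists_mem_descending_ne_zero G a⁻¹ (deg r)
  obtain ⟨F₂, hF₂, hF₂r⟩ := exists_mem_descending_ne_zero G ((ofAdd 1)⁻¹ * a) (deg r)
  have one_eq : a⁻¹ * ofAdd 1 * ((ofAdd 1)⁻¹ * a) = 1 := by group
  set b := (a⁻¹ * ofAdd 1)⁻¹
  have key (d : ZMod N) : F₁ r * F₂ (b • r) =
      F₁ (r * t) * F₂ (b • (r * t)) * weightHom Q a (d + (deg r).toAdd) t := by
    have hd := h _ (one_eq ▸ mul_mem_descending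
      (mul_mem_descending hF₁ (matrixCoeff_mem_descending G (deg r) d)) hF₂)
    simp only [inv_inv] at hd
    rw [matrixCoeff_of_deg_eq (deg_smul a r), matrixCoeff_of_deg_eq ((deg_smul a _).trans hrt),
      smul_mul' a r, weight_mul, deg_smul, ← coe_weightHom] at hd
    refine mul_right_cancel₀ (weight_ne_zero Q (a • r) d) ?_
    linear_combination hd
  have hne : F₁ (r * t) * F₂ (b • (r * t)) ≠ 0 :=
    mul_ne_zero (hF₁r _ hrt) (hF₂r _ ((deg_smul b _).trans hrt))
  ext
  have h := (key (d - (deg r).toAdd)).symm.trans (key (d' - (deg r).toAdd))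
  rw [sub_add_cancel, sub_add_cancel] at h
  exact mul_left_cancel₀ hne h

theorem innerFaithful_rhoQ_of_torsionSubmodule_eq_bot (hQ : torsionSubmodule Q = ⊥) :
    InnerFaithful (rhoQ Q) := by
  refine InnerFaithful.of_injective fun G => injective_of_descending
    (q := G.q.toCoalgHom) (fun r s hrs => ?_) fun y r => ?_
  · by_contra! h
    have hdeg : deg (r⁻¹ * s) = 1 := by
      rw [map_mul, map_inv, deg_eq_of_forall_mem_descending h, inv_mul_cancel]
    let t : (deg : Gamma M N →* _).ker := ⟨r⁻¹ * s, hdeg⟩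
    have hrt : r * t = s := mul_inv_cancel_left r s
    have ht : Additive.ofMul t ∈ torsionSubmodule Q :=
      mem_torsionSubmodule.2 fun a => isOfFinOrder_weightHom fun d =>
        weightHom_eq_of_forall_mem_descending (r := r) (hrt.symm ▸ h) a d 0
    rw [hQ, Submodule.mem_bot] at ht
    exact hrs (inv_mul_eq_one.1 (congrArg (fun v => (v.toMul : Gamma M N)) ht))
  · obtain ⟨F, hF, hFr⟩ := exists_mem_descending_ne_zero G y (deg r)
    exact ⟨F, hF, hFr r rfl⟩

end Separation

/-! ### Inner faithfulness of `ρ_Q` -/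

section Main

open Gamma Module.End Polynomial

variable {k : Type*} [Field k] {M N : ℕ} [NeZero M] [NeZero N] {Q : ZMod M → ZMod N → kˣ}

lemma smul_diff_one_notMem_torsionSubmodule (hθ : ∃ i c, ¬ IsOfFinOrder (theta Q i c)) {m : ℤ}
    (hm : m ≠ 0) : m • diff 1 ∉ torsionSubmodule Q := by
  intro hmem
  obtain ⟨i, c, hic⟩ := hθ
  refine hic (isOfFinOrder_theta_of_div (fun i c => ?_) i c)
  have h := mem_torsionSubmodule.1 hmem (Multiplicative.ofAdd i) (c - 1)
  rw [toMul_zsmul, map_zpow, weightHom_diff_one, toAdd_ofAdd, sub_add_cancel] at h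
  obtain ⟨n, hn, hmn⟩ := isOfFinOrder_iff_zpow_eq_one.1 h
  exact isOfFinOrder_iff_zpow_eq_one.2 ⟨m * n, mul_ne_zero hm hn, by rw [zpow_mul, hmn]⟩

lemma torsionSubmodule_eq_bot (hθ : ∃ i c, ¬ IsOfFinOrder (theta Q i c)) {p : ℕ} (hp : p.Prime)
    {τ : Module.End ℤ (KerDeg M N)} (hτ : torsionSubmodule Q ∈ τ.invtSubmodule)
    (cyclic : ∀ W ∈ τ.invtSubmodule, diff 1 ∈ W → W = ⊤)
    (geom_sum : (∑ j ∈ Finset.range p, τ ^ j) (diff 1) = 0) : torsionSubmodule Q = ⊥ := by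
  have := Fact.mk hp
  refine eq_bot_of_smul_notMem (cyclotomic.monic p ℤ) (cyclotomic.irreducible hp.pos).prime
    (by simpa [cyclotomic_prime] using geom_sum) cyclic hτ
    fun m => smul_diff_one_notMem_torsionSubmodule hθ

theorem theorem5p1_general (hMN : (M = 2 ∧ N.Prime) ∨ (M.Prime ∧ N = 2))
    (hθ : ∃ i c, ¬ IsOfFinOrder (theta Q i c)) : InnerFaithful (rhoQ Q) := by
  refine innerFaithful_rhoQ_of_torsionSubmodule_eq_bot ?_
  obtain ⟨rfl, hN⟩ | ⟨hM, rfl⟩ := hMN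
  · exact torsionSubmodule_eq_bot hθ hN torsionSubmodule_mem_invtSubmodule_conjEnd
      (fun _ => eq_top_of_mem_invtSubmodule_conjEnd) (geom_sum_conjEnd_diff 1)
  · exact torsionSubmodule_eq_bot hθ hM torsionSubmodule_mem_invtSubmodule_shiftEnd
      (fun _ => eq_top_of_mem_invtSubmodule_shiftEnd)
      (by rw [geom_sum_shiftEnd_diff, ZMod.natCast_self, diff_zero])

end Main

end

theorem theorem5p1 {k : Type*} [Field k] [CharZero k] (M N : ℕ) [NeZero M] [NeZero N]
    (hMN : (M = 2 ∧ N.Prime) ∨ (M.Prime ∧ N = 2))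
    (Q : ZMod M → ZMod N → kˣ) (hQ₀ : ∀ c, Q 0 c = 1) (hQ₁ : ∀ i, Q i 0 = 1)
    (hQ : ∃ i c, ¬ ∃ n : ℕ, 0 < n ∧ Q i c ^ n = 1) :
    InnerFaithful (rhoQ Q) :=
  theorem5p1_general hMN <| exists_not_isOfFinOrder_theta hQ₀ hQ₁ <| by
    simpa only [isOfFinOrder_iff_pow_eq_one] using hQ
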